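/- Theorem 2.3 (Saks, general $m$). Let $m \ge 2$ and let $D \subset \mathbb{R}^m$ be a bounded domain, that is, a bounded, non-empty, open and connected set. Let $u \in C^1(D)$ be real-valued. Suppose that for every $x \in D$ $$\lim_{r \to +0} \frac{1}{|S_r|\, r^2} \int_{S_r(x)} \frac{\partial u}{\partial n}\, dS = 0,$$ where $S_r(x)$ is the sphere of radius $r$ centred at $x$ (contained in $D$ for all sufficiently small $r > 0$), $|S_r|$ is its area, $n$ is the exterior unit normal to $S_r(x)$, and $dS$ is the surface area measure. Then $u$ is harmonic in $D$, that is, $u \in C^2(D)$ and $\Delta u = 0$ in $D$. -/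

import Mathlib

open MeasureTheory

noncomputable section

/-- The surface area measure `dS` of the sphere `S_r(x)` of radius `r > 0` centred at `x` in `ℝ^m`,
as a measure on `ℝ^m`: the image of the surface area measure of the unit sphere under
`ω ↦ x + r ω`, multiplied by `r ^ (m - 1)`. -/
def sphereSurfaceMeasure {m : ℕ} (x : EuclideanSpace ℝ (Fin m)) (r : ℝ) :
    Measure (EuclideanSpace ℝ (Fin m)) :=
  ENNReal.ofReal (r ^ (m - 1)) •
    Measure.map
      (fun ω : Metric.sphere (0 : EuclideanSpace ℝ (Fin m)) 1 =>
        x + r • (ω : EuclideanSpace ℝ (Fin m)))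
      (volume : Measure (EuclideanSpace ℝ (Fin m))).toSphere

/-- The area `|S_r|` of the sphere of radius `r` in `ℝ^m` (it does not depend on the centre). -/
def sphereArea (m : ℕ) (r : ℝ) : ℝ :=
  (sphereSurfaceMeasure (0 : EuclideanSpace ℝ (Fin m)) r).real
    (Metric.sphere (0 : EuclideanSpace ℝ (Fin m)) r)

/-- The derivative `∂u/∂n` at the point `y` of the sphere `S_r(x)`, in the direction of the
exterior unit normal `n = (y - x) / r`. -/
def sphereNormalDeriv {m : ℕ} (u : EuclideanSpace ℝ (Fin m) → ℝ)
    (x : EuclideanSpace ℝ (Fin m)) (r : ℝ) (y : EuclideanSpace ℝ (Fin m)) : ℝ :=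
  fderiv ℝ u y (r⁻¹ • (y - x))

/-- The flux `∫_{S_r(x)} ∂u/∂n dS`. -/
def sphereFlux {m : ℕ} (u : EuclideanSpace ℝ (Fin m) → ℝ)
    (x : EuclideanSpace ℝ (Fin m)) (r : ℝ) : ℝ :=
  ∫ y in Metric.sphere x r, sphereNormalDeriv u x r y ∂(sphereSurfaceMeasure x r)

end

/-! Harmonicity is local, so `u` may be replaced near a point by a globally C¹ function `v`.
Averaging with a smooth radial kernel instead of over spheres gives means `ballMean v x R` that are
differentiable in `R`. In polar coordinates the flux hypothesis bounds their `R`-derivative by `C *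
R ^ 2` (`exists_ballMeanDeriv_le`). For a C² function with constant Laplacian `a` this derivative is
`R * a * P`, with `P` the integral of `ballPotential`; if `a > 0`, this dominates `C * R ^ 2` for
small `R`. Hence `v - h + ε‖· - c‖²` with `h` harmonic has no interior local maximum, and `v - h`
obeys the maximum principle (`sub_le_of_sub_le_sphere`).

On a ball the Dirichlet problem with polynomial data has a polynomial solution
(`exists_harmonic_eq_on_sphere`). By Stone–Weierstrass on the sphere and the maximum principle, `v`
is a uniform limit of harmonic polynomials on the closed ball. The mean value property passes to the
limit, and its converse for continuous functions makes `v` harmonic (`harmonicAt_of_ballMean_eq`).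
-/

noncomputable section

open Set Filter Topology InnerProductSpace Laplacian Module

/-! ### Radial averaging kernel, weighted ball means and their derivative in the radius -/

section Kernel

variable {E : Type*} [NormedAddCommGroup E]

/-- A smooth radial bump function supported in the closed unit ball. -/
def ballPotential (y : E) : ℝ := Real.smoothTransition (1 - ‖y‖ ^ 2)

/-- The profile of the averaging kernel: `ballKernel y = ballProfile ‖y‖`. -/
def ballProfile (r : ℝ) : ℝ := 2 * deriv Real.smoothTransition (1 - r ^ 2)

/-- A smooth nonnegative radial averaging kernel, chosen so that `-ballKernel y • y` is the
gradient of `ballPotential` at `y`. -/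
def ballKernel (y : E) : ℝ := ballProfile ‖y‖

theorem contDiff_deriv_smoothTransition {n : ℕ∞} : ContDiff ℝ n (deriv Real.smoothTransition) := by
  have h : ContDiff ℝ ((⊤ : ℕ∞) : WithTop ℕ∞) (deriv Real.smoothTransition) :=
    (contDiff_infty_iff_deriv.1 Real.smoothTransition.contDiff).2
  exact h.of_le (by exact_mod_cast le_top)

theorem ballProfile_nonneg (r : ℝ) : 0 ≤ ballProfile r :=
  mul_nonneg zero_le_two Real.smoothTransition.monotone.deriv_nonneg

theorem deriv_smoothTransition_eq_zero {t : ℝ} (ht : t < 0) :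
    deriv Real.smoothTransition t = 0 := by
  have h : Real.smoothTransition =ᶠ[𝓝 t] fun _ => 0 := by
    filter_upwards [Iio_mem_nhds ht] with s hs
    exact Real.smoothTransition.zero_of_nonpos (le_of_lt hs)
  rw [h.deriv_eq]
  simp

theorem ballProfile_eq_zero {r : ℝ} (hr : 1 < r) : ballProfile r = 0 := by
  rw [ballProfile, deriv_smoothTransition_eq_zero (by nlinarith), mul_zero]

theorem ballKernel_nonneg (y : E) : 0 ≤ ballKernel y := ballProfile_nonneg _

theorem ballPotential_nonneg (y : E) : 0 ≤ ballPotential y := Real.smoothTransition.nonneg _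

theorem ballKernel_eq_zero {y : E} (hy : 1 < ‖y‖) : ballKernel y = 0 := ballProfile_eq_zero hy

theorem ballPotential_eq_zero {y : E} (hy : 1 ≤ ‖y‖) : ballPotential y = 0 :=
  Real.smoothTransition.zero_of_nonpos (by nlinarith)

theorem ballKernel_neg (y : E) : ballKernel (-y) = ballKernel y := by
  simp [ballKernel]

variable [InnerProductSpace ℝ E]

theorem ballKernel_contDiff {n : ℕ∞} : ContDiff ℝ n (ballKernel : E → ℝ) :=
  contDiff_const.mul (contDiff_deriv_smoothTransition.comp
    (contDiff_const.sub (contDiff_norm_sq ℝ)))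

theorem ballPotential_contDiff {n : ℕ∞} : ContDiff ℝ n (ballPotential : E → ℝ) :=
  Real.smoothTransition.contDiff.comp (contDiff_const.sub (contDiff_norm_sq ℝ))

theorem ballKernel_continuous : Continuous (ballKernel : E → ℝ) :=
  (ballKernel_contDiff (n := 0)).continuous

theorem ballPotential_continuous : Continuous (ballPotential : E → ℝ) :=
  (ballPotential_contDiff (n := 0)).continuous

/-- The chain rule through `1 - ‖y‖ ^ 2` produces the factor 2 built into `ballProfile`. -/
theorem fderiv_ballPotential (y z : E) :
    fderiv ℝ ballPotential y z = -(ballKernel y * inner ℝ y z) := by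
  have h1 : HasDerivAt Real.smoothTransition
      (deriv Real.smoothTransition (1 - ‖y‖ ^ 2)) (1 - ‖y‖ ^ 2) :=
    ((Real.smoothTransition.contDiff (n := 1)).differentiable (by simp)).differentiableAt.hasDerivAt
  have h2 : HasFDerivAt (fun y : E => 1 - ‖y‖ ^ 2) (-(2 • innerSL ℝ y)) y :=
    (hasStrictFDerivAt_norm_sq y).hasFDerivAt.const_sub 1
  have h3 := (h1.comp_hasFDerivAt y h2).fderiv
  have h4 : (ballPotential : E → ℝ) = Real.smoothTransition ∘ fun y : E => 1 - ‖y‖ ^ 2 := rfl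
  rw [h4, h3]
  simp [ballKernel, ballProfile]
  ring

theorem ContDiff.continuous_fderiv_line {f : E → ℝ} (hf : ContDiff ℝ 1 f) (x : E) :
    Continuous fun q : ℝ × E => fderiv ℝ f (x + q.1 • q.2) q.2 := by
  have := hf.continuous_fderiv (by simp)
  fun_prop

variable [FiniteDimensional ℝ E]

theorem laplacian_eq_sum_fderiv {f : E → ℝ} (hf : ContDiff ℝ 2 f)
    {ι : Type*} [Fintype ι] (b : OrthonormalBasis ι ℝ E) (x : E) :
    Δ f x = ∑ i, fderiv ℝ (fun y => fderiv ℝ f y (b i)) x (b i) := by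
  rw [laplacian_eq_iteratedFDeriv_orthonormalBasis f b]
  refine Finset.sum_congr rfl fun i _ => ?_
  have hd : DifferentiableAt ℝ (fderiv ℝ f) x :=
    ((hf.fderiv_right (m := 1) (by norm_num)).differentiable (by simp)).differentiableAt
  rw [iteratedFDeriv_two_apply, fderiv_clm_apply hd (by fun_prop)]
  simp

theorem ContDiff.continuous_laplacian {f : E → ℝ} (hf : ContDiff ℝ 2 f) : Continuous (Δ f) := by
  have h : Δ f = fun x => ∑ i, fderiv ℝ (fun y => fderiv ℝ f y (stdOrthonormalBasis ℝ E i)) x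
      (stdOrthonormalBasis ℝ E i) := funext (laplacian_eq_sum_fderiv hf _)
  rw [h]
  refine continuous_finsetSum _ fun i _ => ?_
  have h1 : ContDiff ℝ 1 fun y => fderiv ℝ f y (stdOrthonormalBasis ℝ E i) :=
    (hf.fderiv_right (m := 1) (by norm_num)).clm_apply contDiff_const
  exact (h1.continuous_fderiv (by simp)).clm_apply continuous_const

theorem ballKernel_hasCompactSupport : HasCompactSupport (ballKernel : E → ℝ) :=
  HasCompactSupport.intro (isCompact_closedBall 0 1) fun y hy =>
    ballKernel_eq_zero (by simpa using hy)

theorem ballPotential_hasCompactSupport : HasCompactSupport (ballPotential : E → ℝ) :=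
  HasCompactSupport.intro (isCompact_closedBall 0 1) fun y hy =>
    ballPotential_eq_zero (le_of_lt (by simpa using hy))

variable [MeasurableSpace E] [BorelSpace E]

theorem integrable_mul_ballKernel {f : E → ℝ} (hf : Continuous f) :
    Integrable (fun y => f y * ballKernel y) :=
  (hf.mul ballKernel_continuous).integrable_of_hasCompactSupport
    ballKernel_hasCompactSupport.mul_left

theorem integrable_mul_ballPotential {f : E → ℝ} (hf : Continuous f) :
    Integrable (fun y => f y * ballPotential y) :=
  (hf.mul ballPotential_continuous).integrable_of_hasCompactSupport
    ballPotential_hasCompactSupport.mul_left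

theorem integral_ballPotential_pos : 0 < ∫ y : E, ballPotential y :=
  ballPotential_continuous.integral_pos_of_hasCompactSupport_nonneg_nonzero
    ballPotential_hasCompactSupport ballPotential_nonneg
    (x := 0) (by simp [ballPotential])

theorem integral_ballKernel_pos [Nontrivial E] : 0 < ∫ y : E, ballKernel y := by
  -- The transition rises from 0 to 1 on `[0, 1]`, so its derivative is 1 at some `t`; a vector of
  -- norm `√(1 - t)` is then a point where the kernel is nonzero.
  obtain ⟨t, ht, h⟩ := exists_deriv_eq_slope Real.smoothTransition zero_lt_one
    Real.smoothTransition.continuous.continuousOn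
    ((Real.smoothTransition.contDiff (n := 1)).differentiable (by simp)).differentiableOn
  obtain ⟨y, hy⟩ := exists_norm_eq E (Real.sqrt_nonneg (1 - t))
  refine ballKernel_continuous.integral_pos_of_hasCompactSupport_nonneg_nonzero
    ballKernel_hasCompactSupport ballKernel_nonneg (x := y) ?_
  have : 1 - ‖y‖ ^ 2 = t := by
    rw [hy, Real.sq_sqrt (by linarith [ht.2])]; ring
  simp [ballKernel, ballProfile, this, h]

/-- The weighted average of `f` over the ball of radius `R` centred at `x`. -/
def ballMean (f : E → ℝ) (x : E) (R : ℝ) : ℝ := ∫ y, f (x + R • y) * ballKernel y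

/-- The derivative of `ballMean f x` at `R`, for `f` continuously differentiable. -/
def ballMeanDeriv (f : E → ℝ) (x : E) (R : ℝ) : ℝ :=
  ∫ y, fderiv ℝ f (x + R • y) y * ballKernel y

theorem ballMean_zero (f : E → ℝ) (x : E) :
    ballMean f x 0 = f x * ∫ y : E, ballKernel y := by
  simp [ballMean, integral_const_mul]

theorem hasDerivAt_ballMean {f : E → ℝ} (hf : ContDiff ℝ 1 f) (x : E) (R : ℝ) :
    HasDerivAt (ballMean f x) (ballMeanDeriv f x R) R := by
  have hc := hf.continuous_fderiv_line x
  obtain ⟨C, hC⟩ := ((isCompact_closedBall R 1).prod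
    (isCompact_closedBall (0 : E) 1)).exists_bound_of_continuousOn hc.continuousOn
  have hfc := hf.continuous
  refine (hasDerivAt_integral_of_dominated_loc_of_deriv_le
    (F := fun R y => f (x + R • y) * ballKernel y)
    (F' := fun R y => fderiv ℝ f (x + R • y) y * ballKernel y)
    (bound := fun y => C * ballKernel y) (Metric.ball_mem_nhds R one_pos) ?_ ?_ ?_ ?_ ?_ ?_).2
  · exact .of_forall fun S => (integrable_mul_ballKernel (by fun_prop)).aestronglyMeasurable
  · exact integrable_mul_ballKernel (by fun_prop)
  · exact (integrable_mul_ballKernel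
      (hc.comp (Continuous.prodMk_right R))).aestronglyMeasurable
  · refine .of_forall fun y S hS => ?_
    rw [norm_mul, Real.norm_of_nonneg (ballKernel_nonneg y)]
    by_cases hy : ‖y‖ ≤ 1
    · exact mul_le_mul_of_nonneg_right
        (hC (S, y) ⟨Metric.ball_subset_closedBall hS, by simpa using hy⟩) (ballKernel_nonneg y)
    · simp [ballKernel_eq_zero (not_le.1 hy)]
  · exact integrable_mul_ballKernel continuous_const
  · refine .of_forall fun y S _ => ?_
    have h1 : HasDerivAt (fun S : ℝ => x + S • y) y S := by
      simpa using ((hasDerivAt_id S).smul_const y).const_add x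
    exact (((hf.differentiable (by simp)).differentiableAt.hasFDerivAt).comp_hasDerivAt S
      h1).mul_const _

/-- A weighted divergence theorem: since `ballKernel y • y` is minus the gradient of
`ballPotential`, integrating by parts along each basis vector moves the derivative onto `∂ᵢf(x + R
y)`, and the chain rule gives the factor `R`. -/
theorem ballMeanDeriv_eq_integral_laplacian {f : E → ℝ} (hf : ContDiff ℝ 2 f) (x : E) (R : ℝ) :
    ballMeanDeriv f x R = R * ∫ y, Δ f (x + R • y) * ballPotential y := by
  set b := stdOrthonormalBasis ℝ E
  have hg : ∀ i, ContDiff ℝ 1 fun y => fderiv ℝ f y (b i) := fun i =>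
    (hf.fderiv_right (m := 1) (by norm_num)).clm_apply contDiff_const
  have hline : ∀ i (y : E), HasFDerivAt (fun y => fderiv ℝ f (x + R • y) (b i))
      (R • fderiv ℝ (fun y => fderiv ℝ f y (b i)) (x + R • y)) y := fun i y => by
    have h1 : HasFDerivAt (fun y : E => x + R • y) (R • ContinuousLinearMap.id ℝ E) y :=
      ((hasFDerivAt_id y).const_smul R).const_add x
    convert! (((hg i).differentiable (by simp)).differentiableAt.hasFDerivAt).comp y h1 using 1
    ext z; simp
  have hg' : ∀ i, Continuous fun y => fderiv ℝ (fun y => fderiv ℝ f y (b i)) (x + R • y) (b i) :=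
    fun i => by
      have := (hg i).continuous_fderiv (by simp)
      fun_prop
  have hgc : ∀ i, Continuous fun y => fderiv ℝ f (x + R • y) (b i) := fun i => by
    have := (hg i).continuous
    fun_prop
  have hparts : ∀ i, ∫ y, fderiv ℝ f (x + R • y) (b i) * (inner ℝ y (b i) * ballKernel y) =
      R * ∫ y, fderiv ℝ (fun y => fderiv ℝ f y (b i)) (x + R • y) (b i) * ballPotential y := by
    intro i
    have key := integral_mul_fderiv_eq_neg_fderiv_mul_of_integrable (μ := (volume : Measure E))
      (f := fun y => fderiv ℝ f (x + R • y) (b i)) (g := ballPotential) (v := b i)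
      ?_ ?_ ?_ (fun y _ => (hline i y).differentiableAt)
      (fun y _ => ((ballPotential_contDiff (n := 1)).differentiable (by simp)).differentiableAt)
    · simp only [fderiv_ballPotential, (hline i _).fderiv, FunLike.coe_smul,
        Pi.smul_apply, smul_eq_mul] at key
      rw [← integral_const_mul]
      simp only [mul_neg, integral_neg, neg_inj] at key
      rw [← sub_eq_zero] at key ⊢
      rw [← key]
      congr 2
      · funext y; ring
      · funext y; ring
    · simp only [(hline i _).fderiv, FunLike.coe_smul, Pi.smul_apply, smul_eq_mul]
      exact integrable_mul_ballPotential (continuous_const.mul (hg' i))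
    · simp only [fderiv_ballPotential]
      have : Integrable fun y => (-(fderiv ℝ f (x + R • y) (b i) * inner ℝ y (b i)))
          * ballKernel y := integrable_mul_ballKernel (by have := hgc i; fun_prop)
      refine this.congr (.of_forall fun y => ?_)
      simp only; ring
    · exact integrable_mul_ballPotential (hgc i)
  have h1 : ∀ y, fderiv ℝ f (x + R • y) y * ballKernel y =
      ∑ i, fderiv ℝ f (x + R • y) (b i) * (inner ℝ y (b i) * ballKernel y) := by
    intro y
    have hT : ∀ T : E →L[ℝ] ℝ, T y = ∑ i, T (b i) * inner ℝ y (b i) := fun T => by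
      conv_lhs => rw [← b.sum_repr' y]
      simp [mul_comm, real_inner_comm]
    rw [hT, Finset.sum_mul]
    exact Finset.sum_congr rfl fun i _ => mul_assoc _ _ _
  have h2 : ∀ y, Δ f (x + R • y) * ballPotential y =
      ∑ i, fderiv ℝ (fun y => fderiv ℝ f y (b i)) (x + R • y) (b i) * ballPotential y := by
    intro y
    rw [laplacian_eq_sum_fderiv hf b, Finset.sum_mul]
  simp only [ballMeanDeriv, h1, h2]
  rw [integral_finsetSum, integral_finsetSum, Finset.mul_sum]
  · exact Finset.sum_congr rfl fun i _ => hparts i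
  · exact fun i _ => integrable_mul_ballPotential (hg' i)
  · intro i _
    have : Integrable fun y => (fderiv ℝ f (x + R • y) (b i) * inner ℝ y (b i))
        * ballKernel y := integrable_mul_ballKernel (by have := hgc i; fun_prop)
    refine this.congr (.of_forall fun y => ?_)
    simp only; ring

end Kernel

/-! ### Polar coordinates -/

section Polar

variable {E : Type*} [NormedAddCommGroup E] [NormedSpace ℝ E]

theorem smul_homeomorphUnitSphereProd (y : ({(0)}ᶜ : Set E)) :
    ((homeomorphUnitSphereProd E y).2 : ℝ) • ((homeomorphUnitSphereProd E y).1 : E) = y := by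
  rw [← homeomorphUnitSphereProd_symm_apply_coe, Homeomorph.symm_apply_apply]

variable [FiniteDimensional ℝ E] [MeasurableSpace E] [BorelSpace E] [Nontrivial E]
  (μ : Measure E) [μ.IsAddHaarMeasure]

theorem integral_eq_integral_comap_compl_zero (f : E → ℝ) :
    ∫ y, f y ∂μ = ∫ y : ({(0)}ᶜ : Set E), f y ∂(μ.comap (↑)) := by
  rw [integral_subtype_comap (measurableSet_singleton _).compl f, restrict_compl_singleton]

/-- Integration in polar coordinates. -/
theorem integral_eq_integral_toSphere {f : E → ℝ} (hf : Integrable f μ) :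
    ∫ y, f y ∂μ = ∫ r : Ioi (0 : ℝ), (∫ ω : Metric.sphere (0 : E) 1, f (r.1 • ω.1) ∂μ.toSphere)
      ∂(Measure.volumeIoiPow (finrank ℝ E - 1)) := by
  have hmp := μ.measurePreserving_homeomorphUnitSphereProd
  have hemb := (homeomorphUnitSphereProd E).measurableEmbedding
  have h1 := hmp.integral_comp hemb
    (fun p : Metric.sphere (0 : E) 1 × Ioi (0 : ℝ) => f (p.2.1 • p.1.1))
  have h2 := hmp.integrable_comp_emb hemb
    (g := fun p : Metric.sphere (0 : E) 1 × Ioi (0 : ℝ) => f (p.2.1 • p.1.1))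
  simp only [Function.comp_def, smul_homeomorphUnitSphereProd] at h1 h2
  rw [integral_eq_integral_comap_compl_zero, h1, integral_prod_symm]
  refine h2.1 ?_
  have h3 : IntegrableOn f ({(0)}ᶜ : Set E) μ := hf.integrableOn
  rwa [integrableOn_iff_comap_subtypeVal (measurableSet_singleton _).compl] at h3

theorem integrable_volumeIoiPow_of_integrable_norm {g : ℝ → ℝ}
    (hg : Integrable (fun y : E => g ‖y‖) μ) :
    Integrable (fun r : Ioi (0 : ℝ) => g r) (Measure.volumeIoiPow (finrank ℝ E - 1)) := by
  have h2 := μ.measurePreserving_homeomorphUnitSphereProd.integrable_comp_emb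
    (homeomorphUnitSphereProd E).measurableEmbedding
    (g := fun p : Metric.sphere (0 : E) 1 × Ioi (0 : ℝ) => g p.2)
  simp only [Function.comp_def, homeomorphUnitSphereProd_apply_snd_coe] at h2
  have h3 : IntegrableOn (fun y : E => g ‖y‖) ({(0)}ᶜ : Set E) μ := hg.integrableOn
  rw [integrableOn_iff_comap_subtypeVal (measurableSet_singleton _).compl] at h3
  exact (Integrable.comp_snd_iff (β := Ioi 0) (f := fun r => g r.1)
    (by simp)).1 (h2.1 h3)

end Polar

/-! ### From the flux condition to the derivative of the ball means -/

section Flux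

variable {m : ℕ}

local notation "𝔼" => EuclideanSpace ℝ (Fin m)

theorem measurableEmbedding_sphere_map (x : 𝔼) {r : ℝ} (hr : 0 < r) :
    MeasurableEmbedding fun ω : Metric.sphere (0 : 𝔼) 1 => x + r • (ω : 𝔼) :=
  (((Homeomorph.smulOfNeZero r hr.ne').trans
    (Homeomorph.addLeft x)).measurableEmbedding).comp
    (MeasurableEmbedding.subtype_coe Metric.isClosed_sphere.measurableSet)

theorem preimage_sphere_map (x : 𝔼) {r : ℝ} (hr : 0 < r) :
    (fun ω : Metric.sphere (0 : 𝔼) 1 => x + r • (ω : 𝔼)) ⁻¹' Metric.sphere x r = univ := by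
  ext ω
  simp [norm_smul, abs_of_pos hr]

theorem sphereFlux_eq (u : 𝔼 → ℝ) (x : 𝔼) {r : ℝ} (hr : 0 < r) :
    sphereFlux u x r = r ^ (m - 1) * ∫ ω : Metric.sphere (0 : 𝔼) 1,
      fderiv ℝ u (x + r • (ω : 𝔼)) ω ∂(volume : Measure 𝔼).toSphere := by
  rw [sphereFlux, sphereSurfaceMeasure, Measure.restrict_smul, integral_smul_measure,
    (measurableEmbedding_sphere_map x hr).setIntegral_map, preimage_sphere_map x hr,
    Measure.restrict_univ, ENNReal.toReal_ofReal (by positivity), smul_eq_mul]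
  simp [sphereNormalDeriv, smul_smul, inv_mul_cancel₀ hr.ne']

/-- Small spheres about `x` lie in `U`; this carries the flux hypothesis over to a global extension.
-/
theorem sphereFlux_eventuallyEq {u v : 𝔼 → ℝ} {U : Set 𝔼} (hU : IsOpen U) (huv : EqOn v u U)
    {x : 𝔼} (hx : x ∈ U) : sphereFlux v x =ᶠ[𝓝[>] 0] sphereFlux u x := by
  obtain ⟨δ, hδ, hsub⟩ := Metric.isOpen_iff.1 hU x hx
  filter_upwards [Ioo_mem_nhdsGT hδ] with r hr
  rw [sphereFlux_eq v x hr.1, sphereFlux_eq u x hr.1]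
  congr 2
  funext ω
  have hmem : x + r • (ω : 𝔼) ∈ U := hsub (by
    simpa [norm_smul, abs_of_pos hr.1] using hr.2)
  rw [(huv.eventuallyEq_of_mem (hU.mem_nhds hmem)).fderiv_eq]

theorem sphereArea_eq {r : ℝ} (hr : 0 < r) :
    sphereArea m r = r ^ (m - 1) * (volume : Measure 𝔼).toSphere.real univ := by
  rw [sphereArea, sphereSurfaceMeasure, measureReal_ennreal_smul_apply,
    ENNReal.toReal_ofReal (by positivity), measureReal_def,
    (measurableEmbedding_sphere_map 0 hr).map_apply, preimage_sphere_map 0 hr, measureReal_def]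

/-- The flux condition controls the derivative of the weighted ball means. -/
theorem exists_ballMeanDeriv_le [Nontrivial 𝔼] {v : 𝔼 → ℝ} (hv : ContDiff ℝ 1 v) (x : 𝔼)
    (h : Tendsto (fun r : ℝ => 1 / (sphereArea m r * r ^ 2) * sphereFlux v x r)
      (𝓝[>] 0) (𝓝 0)) :
    ∃ C : ℝ, ∃ δ > 0, ∀ R ∈ Ioo 0 δ, |ballMeanDeriv v x R| ≤ C * R ^ 2 := by
  set σ := (volume : Measure 𝔼).toSphere
  have hσ : 0 < σ.real univ := by
    rw [measureReal_def]
    refine ENNReal.toReal_pos ?_ (measure_ne_top _ _)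
    exact Measure.measure_univ_ne_zero.2 (volume : Measure 𝔼).toSphere_ne_zero
  set Φ : ℝ → ℝ := fun s => ∫ ω : Metric.sphere (0 : 𝔼) 1, fderiv ℝ v (x + s • (ω : 𝔼)) ω ∂σ
  obtain ⟨δ, hδ, hΦ⟩ : ∃ δ > 0, ∀ s ∈ Ioo 0 δ, |Φ s| ≤ σ.real univ * s ^ 2 := by
    -- Only boundedness of the normalised flux near 0 is needed below, not its limit.
    have h1 : ∀ᶠ r in 𝓝[>] (0 : ℝ), |1 / (sphereArea m r * r ^ 2) * sphereFlux v x r| < 1 := by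
      have := (h.abs).eventually_lt_const (u := 1) (by simp)
      exact this
    obtain ⟨δ, hδ, hsub⟩ := mem_nhdsGT_iff_exists_Ioo_subset.1 h1
    refine ⟨δ, hδ, fun s hs => ?_⟩
    have h2 : |1 / (sphereArea m s * s ^ 2) * sphereFlux v x s| ≤ 1 := le_of_lt (hsub hs)
    have hs0 : 0 < s := hs.1
    have h3 : 1 / (sphereArea m s * s ^ 2) * sphereFlux v x s = Φ s / (σ.real univ * s ^ 2) := by
      rw [sphereArea_eq hs0, sphereFlux_eq v x hs0]
      have : s ^ (m - 1) ≠ 0 := by positivity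
      change 1 / (s ^ (m - 1) * σ.real univ * s ^ 2) * (s ^ (m - 1) * Φ s) = _
      field_simp
    rw [h3, abs_div, abs_of_pos (by positivity : 0 < σ.real univ * s ^ 2),
      div_le_one (by positivity)] at h2
    exact h2
  set ν := Measure.volumeIoiPow (finrank ℝ 𝔼 - 1)
  -- One power of `r` comes from the direction `r • ω`, two from the bound on `Φ (R * r)`.
  have hint : Integrable (fun r : Ioi (0 : ℝ) => (r : ℝ) ^ 3 * ballProfile r) ν :=
    integrable_volumeIoiPow_of_integrable_norm (E := 𝔼) volume
      (g := fun r => r ^ 3 * ballProfile r)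
      (integrable_mul_ballKernel (f := fun y : 𝔼 => ‖y‖ ^ 3) (by fun_prop))
  refine ⟨σ.real univ * ∫ r : Ioi (0 : ℝ), (r : ℝ) ^ 3 * ballProfile r ∂ν, δ, hδ, fun R hR => ?_⟩
  have hpolar := integral_eq_integral_toSphere (volume : Measure 𝔼)
    (integrable_mul_ballKernel ((hv.continuous_fderiv_line x).comp (Continuous.prodMk_right R)))
  simp only [Function.comp_def] at hpolar
  rw [ballMeanDeriv, hpolar]
  have hbound : ∀ r : Ioi (0 : ℝ), ‖∫ ω : Metric.sphere (0 : 𝔼) 1,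
      fderiv ℝ v (x + R • (r.1 • ω.1)) (r.1 • ω.1) * ballKernel (r.1 • ω.1) ∂σ‖ ≤
      (σ.real univ * R ^ 2) * ((r : ℝ) ^ 3 * ballProfile r) := by
    rintro ⟨r, hr⟩
    have hr0 : 0 < r := hr
    have h1 : ∀ ω : Metric.sphere (0 : 𝔼) 1,
        fderiv ℝ v (x + R • (r • ω.1)) (r • ω.1) * ballKernel (r • ω.1) =
        (r * ballProfile r) * fderiv ℝ v (x + (R * r) • ω.1) ω.1 := by
      intro ω
      have : ballKernel (r • ω.1) = ballProfile r := by
        simp [ballKernel, norm_smul, abs_of_pos hr0]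
      rw [this, smul_smul, map_smul, smul_eq_mul]
      ring
    simp only [h1]
    rw [integral_const_mul, norm_mul, Real.norm_of_nonneg
      (mul_nonneg hr0.le (ballProfile_nonneg r))]
    by_cases hr1 : r ≤ 1
    · have h2 : |Φ (R * r)| ≤ σ.real univ * (R * r) ^ 2 :=
        hΦ _ ⟨mul_pos hR.1 hr0, lt_of_le_of_lt (mul_le_of_le_one_right hR.1.le hr1) hR.2⟩
      calc r * ballProfile r * |Φ (R * r)|
          ≤ r * ballProfile r * (σ.real univ * (R * r) ^ 2) :=
            mul_le_mul_of_nonneg_left h2 (mul_nonneg hr0.le (ballProfile_nonneg r))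
        _ = _ := by ring
    · simp [ballProfile_eq_zero (not_le.1 hr1)]
  refine (norm_integral_le_of_norm_le (hint.const_mul _) (.of_forall hbound)).trans ?_
  rw [integral_const_mul]
  apply le_of_eq
  ring

end Flux

/-! ### Maximum principle -/

section MaximumPrinciple

variable {E : Type*} [NormedAddCommGroup E] [InnerProductSpace ℝ E] [FiniteDimensional ℝ E]

theorem laplacian_norm_sub_sq (c x : E) :
    Δ (fun y : E => ‖y - c‖ ^ 2) x = 2 * finrank ℝ E := by
  have hC : ContDiff ℝ 2 fun y : E => ‖y - c‖ ^ 2 := (contDiff_id.sub contDiff_const).norm_sq ℝ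
  rw [laplacian_eq_sum_fderiv hC (stdOrthonormalBasis ℝ E)]
  have h1 : ∀ y z : E, fderiv ℝ (fun y : E => ‖y - c‖ ^ 2) y z = 2 * inner ℝ (y - c) z := by
    intro y z
    have h := ((hasFDerivAt_id y).sub_const c).norm_sq
    rw [show (fun y : E => ‖y - c‖ ^ 2) = fun y : E => ‖id y - c‖ ^ 2 from rfl, h.fderiv]
    simp [inner_sub_left]
  have h2 : ∀ b y : E, fderiv ℝ (fun y : E => 2 * inner ℝ (y - c) b) y b = 2 * inner ℝ b b := by
    intro b y
    have h := (((hasFDerivAt_id y).sub_const c).inner ℝ (hasFDerivAt_const b y)).const_mul 2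
    rw [show (fun y : E => 2 * inner ℝ (y - c) b) = fun y : E => 2 * inner ℝ (id y - c) b from rfl,
      h.fderiv]
    simp
  simp only [h1, h2]
  simp [mul_comm]

variable [MeasurableSpace E] [BorelSpace E]

theorem ballMean_add {f g : E → ℝ} (hf : Continuous f) (hg : Continuous g) (x : E) (R : ℝ) :
    ballMean (fun y => f y + g y) x R = ballMean f x R + ballMean g x R := by
  rw [ballMean, ballMean, ballMean, ← integral_add]
  · simp only [add_mul]
  · exact integrable_mul_ballKernel (by fun_prop)
  · exact integrable_mul_ballKernel (by fun_prop)

theorem ballMean_mono {f g : E → ℝ} (hf : Continuous f) (hg : Continuous g) {x : E} {R : ℝ}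
    (hR : 0 ≤ R) (h : ∀ y ∈ Metric.closedBall x R, f y ≤ g y) :
    ballMean f x R ≤ ballMean g x R := by
  refine integral_mono (integrable_mul_ballKernel (by fun_prop))
    (integrable_mul_ballKernel (by fun_prop)) fun y => ?_
  by_cases hy : ‖y‖ ≤ 1
  · refine mul_le_mul_of_nonneg_right (h _ ?_) (ballKernel_nonneg y)
    simpa [norm_smul, abs_of_nonneg hR] using mul_le_of_le_one_right hR hy
  · simp [ballKernel_eq_zero (not_le.1 hy)]

theorem ballMean_const (a : ℝ) (x : E) (R : ℝ) :
    ballMean (fun _ => a) x R = a * ∫ y : E, ballKernel y := by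
  simp [ballMean, integral_const_mul]

/-- If the weighted ball means of `v` at `x` grow at most cubically and `f` has constant positive
Laplacian, then `v + f` has no local maximum at `x`. -/
theorem not_isLocalMax_add {v f : E → ℝ} (hv : ContDiff ℝ 1 v) (hf : ContDiff ℝ 2 f) {a : ℝ}
    (ha : 0 < a) (hΔ : ∀ x, Δ f x = a) {x : E}
    (hx : ∃ C : ℝ, ∃ δ > 0, ∀ R ∈ Ioo 0 δ, |ballMeanDeriv v x R| ≤ C * R ^ 2) :
    ¬ IsLocalMax (fun y => v y + f y) x := by
  intro hmax
  obtain ⟨C, δ, hδ, hC⟩ := hx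
  obtain ⟨r, hr, hball⟩ := Metric.nhds_basis_closedBall.mem_iff.1 hmax
  set P := ∫ y : E, ballPotential y
  have hP : 0 < P := integral_ballPotential_pos
  -- The three bounds keep the estimate `hC` valid, keep the ball where `x` is maximal, and make `s
  -- * (a * P)` beat `C * s ^ 2` for `0 < s < R`.
  set R := min (min (δ / 2) r) (a * P / (2 * (|C| + 1)))
  have hR0 : 0 < R := by positivity
  have hRδ : R < δ := lt_of_le_of_lt ((min_le_left _ _).trans (min_le_left _ _)) (by linarith)
  have hRr : R ≤ r := (min_le_left _ _).trans (min_le_right _ _)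
  have hRC : R * (|C| + 1) < a * P := by
    have h1 : R ≤ a * P / (2 * (|C| + 1)) := min_le_right _ _
    have h2 : 0 < |C| + 1 := by positivity
    rw [le_div_iff₀ (by positivity)] at h1
    nlinarith [mul_pos ha hP]
  have hd : ∀ s, HasDerivAt (fun s => ballMean v x s + ballMean f x s)
      (ballMeanDeriv v x s + s * (a * P)) s := fun s => by
    have h := hasDerivAt_ballMean (hf.of_le (by norm_num)) x s
    rw [ballMeanDeriv_eq_integral_laplacian hf] at h
    simp only [hΔ, integral_const_mul] at h
    exact (hasDerivAt_ballMean hv x s).add h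
  have hmono : StrictMonoOn (fun s => ballMean v x s + ballMean f x s) (Icc 0 R) := by
    refine strictMonoOn_of_deriv_pos (convex_Icc 0 R)
      (fun s _ => (hd s).continuousAt.continuousWithinAt) fun s hs => ?_
    rw [interior_Icc] at hs
    rw [(hd s).deriv]
    have h1 := (abs_le.1 (hC s ⟨hs.1, hs.2.trans hRδ⟩)).1
    have h2 : C * s ^ 2 ≤ s * (R * |C|) := by
      have : C * s ≤ R * |C| := by
        calc C * s ≤ |C| * s := mul_le_mul_of_nonneg_right (le_abs_self C) hs.1.le
          _ ≤ |C| * R := mul_le_mul_of_nonneg_left hs.2.le (abs_nonneg C)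
          _ = R * |C| := mul_comm _ _
      calc C * s ^ 2 = s * (C * s) := by ring
        _ ≤ _ := mul_le_mul_of_nonneg_left this hs.1.le
    have h3 : s * (R * |C|) < s * (a * P) := mul_lt_mul_of_pos_left (by nlinarith) hs.1
    linarith
  have hlt := hmono (left_mem_Icc.2 hR0.le) (right_mem_Icc.2 hR0.le) hR0
  simp only [← ballMean_add hv.continuous hf.continuous] at hlt
  have hle : ballMean (fun y => v y + f y) x R ≤ ballMean (fun _ => v x + f x) x R :=
    ballMean_mono (hv.continuous.add hf.continuous) continuous_const hR0.le fun y hy =>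
      hball (Metric.closedBall_subset_closedBall hRr hy)
  rw [ballMean_const] at hle
  rw [ballMean_zero] at hlt
  exact absurd hlt (not_lt.2 hle)

/-- The maximum principle for the difference of `v` and a harmonic function. -/
theorem sub_le_of_sub_le_sphere [Nontrivial E] {v h : E → ℝ} (hv : ContDiff ℝ 1 v)
    (hh : ContDiff ℝ 2 h) (hΔ : ∀ x, Δ h x = 0) {c : E} {ρ : ℝ}
    (hmean : ∀ x ∈ Metric.ball c ρ,
      ∃ C : ℝ, ∃ δ > 0, ∀ R ∈ Ioo 0 δ, |ballMeanDeriv v x R| ≤ C * R ^ 2)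
    {B : ℝ} (hB : ∀ x ∈ Metric.sphere c ρ, v x - h x ≤ B) {x : E}
    (hx : x ∈ Metric.closedBall c ρ) : v x - h x ≤ B := by
  by_contra! hlt
  -- The penalty `ε‖· - c‖²` equals `ε * ρ ^ 2` on the sphere, too little to close the gap there, so
  -- the maximum over the closed ball is interior.
  obtain ⟨ε, hε, hερ⟩ : ∃ ε > 0, ε * ρ ^ 2 < v x - h x - B := by
    refine ⟨(v x - h x - B) / (2 * (ρ ^ 2 + 1)), div_pos (by linarith) (by positivity), ?_⟩
    rw [div_mul_eq_mul_div, div_lt_iff₀ (by positivity)]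
    nlinarith [sq_nonneg ρ]
  have hq : ContDiff ℝ 2 fun y : E => ‖y - c‖ ^ 2 := (contDiff_id.sub contDiff_const).norm_sq ℝ
  have hf : ContDiff ℝ 2 ((ε • fun y : E => ‖y - c‖ ^ 2) - h) := (contDiff_const.smul hq).sub hh
  have hfΔ : ∀ y, Δ ((ε • fun y : E => ‖y - c‖ ^ 2) - h) y = ε * (2 * finrank ℝ E) := fun y => by
    have h1 : ContDiff ℝ 2 (ε • fun y : E => ‖y - c‖ ^ 2) := contDiff_const.smul hq
    rw [h1.contDiffAt.laplacian_sub hh.contDiffAt, laplacian_smul _ hq.contDiffAt, hΔ,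
      laplacian_norm_sub_sq]
    simp
  obtain ⟨z, hz, hzmax⟩ := (isCompact_closedBall c ρ).exists_isMaxOn ⟨x, hx⟩
    (hv.continuous.add hf.continuous).continuousOn
  have hxz := hzmax hx
  simp only [mem_ofPred_eq, Pi.sub_apply, Pi.smul_apply, smul_eq_mul, Pi.add_apply] at hxz
  rcases (Metric.mem_closedBall.1 hz).lt_or_eq with hzlt | hzeq
  · refine not_isLocalMax_add hv hf (mul_pos hε (mul_pos two_pos ?_)) hfΔ (hmean z hzlt) ?_
    · exact_mod_cast finrank_pos
    · exact hzmax.isLocalMax (Filter.mem_of_superset (Metric.isOpen_ball.mem_nhds hzlt)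
        Metric.ball_subset_closedBall)
  · have h1 := hB z hzeq
    have h2 : ‖z - c‖ = ρ := by rw [← dist_eq_norm]; exact hzeq
    rw [h2] at hxz
    have h3 : 0 ≤ ε * ‖x - c‖ ^ 2 := by positivity
    linarith

end MaximumPrinciple

/-! ### Polynomial solution of the Dirichlet problem on a ball -/

namespace MvPolynomial

theorem totalDegree_pderiv_le {σ R : Type*} [CommSemiring R] (i : σ) (p : MvPolynomial σ R) :
    (pderiv i p).totalDegree ≤ p.totalDegree - 1 := by
  classical
  refine Finset.sup_le fun s hs => ?_
  have h1 : s + Finsupp.single i 1 ∈ p.support := by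
    rw [mem_support_iff, coeff_pderiv] at hs
    exact mem_support_iff.2 (left_ne_zero_of_mul hs)
  have h2 := le_totalDegree h1
  rw [Finsupp.sum_add_index' (by simp) (by simp), Finsupp.sum_single_index rfl] at h2
  omega

variable {m : ℕ}

local notation "𝔼" => EuclideanSpace ℝ (Fin m)

/-- The polynomial function on Euclidean space defined by a polynomial. -/
def toFun (p : MvPolynomial (Fin m) ℝ) (x : 𝔼) : ℝ := eval (fun i => x i) p

theorem contDiff_toFun (p : MvPolynomial (Fin m) ℝ) {n : WithTop ℕ∞} :
    ContDiff ℝ n (toFun p : 𝔼 → ℝ) := by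
  induction p using MvPolynomial.induction_on with
  | C a =>
    have : (toFun (C a) : 𝔼 → ℝ) = fun _ => a := by ext; simp [toFun]
    rw [this]
    exact contDiff_const
  | add p q hp hq =>
    have : (toFun (p + q) : 𝔼 → ℝ) = fun y => toFun p y + toFun q y := by ext; simp [toFun]
    rw [this]
    exact hp.add hq
  | mul_X p i hp =>
    have h : ContDiff ℝ n fun x : 𝔼 => x i := (EuclideanSpace.proj (𝕜 := ℝ) i).contDiff
    have : (toFun (p * X i) : 𝔼 → ℝ) = fun y => toFun p y * y i := by ext; simp [toFun]
    rw [this]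
    exact hp.mul h

theorem fderiv_toFun (p : MvPolynomial (Fin m) ℝ) (x : 𝔼) (i : Fin m) :
    fderiv ℝ (toFun p) x (EuclideanSpace.basisFun (Fin m) ℝ i) = toFun (pderiv i p) x := by
  have hdiff : ∀ q : MvPolynomial (Fin m) ℝ, DifferentiableAt ℝ (toFun q : 𝔼 → ℝ) x := fun q =>
    ((contDiff_toFun q (n := 1)).differentiable (by simp)).differentiableAt
  induction p using MvPolynomial.induction_on with
  | C a =>
    have : (toFun (C a) : 𝔼 → ℝ) = fun _ => a := by ext; simp [toFun]
    rw [this]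
    simp [toFun]
  | add p q hp hq =>
    have : (toFun (p + q) : 𝔼 → ℝ) = toFun p + toFun q := by ext; simp [toFun]
    rw [this, fderiv_add (hdiff p) (hdiff q), _root_.add_apply, hp, hq]
    simp [toFun]
  | mul_X p j hp =>
    have : (toFun (p * X j) : 𝔼 → ℝ) = fun y => toFun p y * EuclideanSpace.proj (𝕜 := ℝ) j y := by
      ext; simp [toFun]
    rw [this, fderiv_fun_mul (hdiff p) (EuclideanSpace.proj (𝕜 := ℝ) j).differentiableAt,
      ContinuousLinearMap.fderiv]
    simp only [_root_.add_apply, _root_.smul_apply, hp, smul_eq_mul]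
    rw [pderiv_mul, pderiv_X]
    by_cases hij : i = j
    · subst hij
      simp [toFun]
      ring
    · simp [toFun, Ne.symm hij, mul_comm]

/-- The Laplacian as a linear map on polynomials. -/
def laplacian : MvPolynomial (Fin m) ℝ →ₗ[ℝ] MvPolynomial (Fin m) ℝ :=
  ∑ i, (pderiv i).toLinearMap ∘ₗ (pderiv i).toLinearMap

theorem laplacian_toFun (p : MvPolynomial (Fin m) ℝ) (x : 𝔼) :
    Δ (toFun p) x = toFun (laplacian p) x := by
  rw [laplacian_eq_sum_fderiv (contDiff_toFun p) (EuclideanSpace.basisFun (Fin m) ℝ)]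
  simp only [fderiv_toFun]
  simp [laplacian, toFun]

theorem totalDegree_laplacian_le (p : MvPolynomial (Fin m) ℝ) :
    (laplacian p).totalDegree ≤ p.totalDegree - 2 := by
  simp only [laplacian, LinearMap.sum_apply]
  refine (totalDegree_finsetSum _ _).trans (Finset.sup_le fun i _ => ?_)
  have h1 := totalDegree_pderiv_le i p
  have h2 := totalDegree_pderiv_le i (pderiv i p)
  exact h2.trans (by omega)

/-- The polynomial `ρ² - ‖x - c‖²`, which vanishes on the sphere of radius `ρ` about `c`. -/
def spherePoly (c : 𝔼) (ρ : ℝ) : MvPolynomial (Fin m) ℝ :=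
  C (ρ ^ 2) - ∑ i, (X i - C (c i)) ^ 2

theorem toFun_spherePoly (c : 𝔼) (ρ : ℝ) (x : 𝔼) :
    toFun (spherePoly c ρ) x = ρ ^ 2 - ‖x - c‖ ^ 2 := by
  simp [toFun, spherePoly, EuclideanSpace.norm_sq_eq]

theorem totalDegree_spherePoly_le (c : 𝔼) (ρ : ℝ) : (spherePoly c ρ).totalDegree ≤ 2 := by
  refine (totalDegree_sub _ _).trans (max_le (by rw [totalDegree_C]; exact Nat.zero_le _) ?_)
  refine (totalDegree_finsetSum _ _).trans (Finset.sup_le fun i _ => ?_)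
  refine (totalDegree_pow _ _).trans ?_
  have : (X i - C (c i) : MvPolynomial (Fin m) ℝ).totalDegree ≤ 1 :=
    (totalDegree_sub _ _).trans (max_le (by simp) (by simp))
  omega

/-- The ball contains a product of intervals, and a polynomial vanishing on a product of infinite
sets is zero. -/
theorem eq_zero_of_toFun_eq_zero_on_ball {c : 𝔼} {ρ : ℝ} (hρ : 0 < ρ)
    {p : MvPolynomial (Fin m) ℝ} (hp : ∀ x ∈ Metric.ball c ρ, toFun p x = 0) : p = 0 := by
  have hopen : IsOpen ((WithLp.toLp 2 : (Fin m → ℝ) → 𝔼) ⁻¹' Metric.ball c ρ) :=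
    Metric.isOpen_ball.preimage (PiLp.continuous_toLp 2 _)
  have hmem : (WithLp.ofLp c) ∈ ((WithLp.toLp 2 : (Fin m → ℝ) → 𝔼) ⁻¹' Metric.ball c ρ) := by
    simpa using hρ
  obtain ⟨ε, hε, hsub⟩ := Metric.isOpen_iff.1 hopen _ hmem
  refine funext_set (fun i => Metric.ball (c i) ε) (fun i => ?_) fun y hy => ?_
  · rw [Real.ball_eq_Ioo]
    exact Ioo_infinite (by linarith)
  · rw [map_zero]
    refine hp (WithLp.toLp 2 y) (hsub ?_)
    rw [ball_pi _ hε]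
    exact hy

/-- Stone–Weierstrass for the algebra generated by the coordinates, which separate points. -/
theorem exists_toFun_near (K : Set 𝔼) (hK : IsCompact K) {v : 𝔼 → ℝ} (hv : Continuous v)
    {ε : ℝ} (hε : 0 < ε) :
    ∃ q : MvPolynomial (Fin m) ℝ, ∀ x ∈ K, |v x - toFun q x| ≤ ε := by
  have : CompactSpace K := isCompact_iff_compactSpace.1 hK
  let coord : Fin m → C(K, ℝ) := fun i => ⟨fun x => x.1 i, by fun_prop⟩
  have heval : ∀ (q : MvPolynomial (Fin m) ℝ) (x : K), aeval coord q x = toFun q x.1 := by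
    intro q x
    induction q using MvPolynomial.induction_on with
    | C a => simp [toFun]
    | add p q hp hq => simp [toFun] at hp hq ⊢; rw [hp, hq]
    | mul_X p i hp => simp [toFun] at hp ⊢; rw [hp]; simp [coord]
  have hsep : (aeval coord : MvPolynomial (Fin m) ℝ →ₐ[ℝ] C(K, ℝ)).range.SeparatesPoints := by
    intro x y hxy
    have hne : x.1 ≠ y.1 := fun h => hxy (Subtype.ext h)
    obtain ⟨i, hi⟩ : ∃ i, x.1 i ≠ y.1 i := by
      by_contra! h
      exact hne (by ext i; exact h i)
    exact ⟨coord i, ⟨coord i, ⟨X i, by simp⟩, rfl⟩, hi⟩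
  obtain ⟨⟨g, q, rfl⟩, hg⟩ :=
    ContinuousMap.exists_mem_subalgebra_near_continuousMap_of_separatesPoints _ hsep
      ⟨fun x : K => v x.1, by fun_prop⟩ ε hε
  refine ⟨q, fun x hx => ?_⟩
  have h1 := (ContinuousMap.norm_coe_le_norm _ ⟨x, hx⟩).trans hg.le
  rw [abs_sub_comm]
  have h2 := heval q ⟨x, hx⟩
  simpa [← h2] using h1

variable [Nontrivial (EuclideanSpace ℝ (Fin m))]

/-- The product is harmonic and vanishes on the sphere, hence vanishes in the ball, where
`spherePoly` is positive. -/
theorem laplacian_spherePoly_mul_injective {c : 𝔼} {ρ : ℝ} (hρ : 0 < ρ)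
    {p : MvPolynomial (Fin m) ℝ} (hp : laplacian (spherePoly c ρ * p) = 0) : p = 0 := by
  have hΔ : ∀ q : MvPolynomial (Fin m) ℝ, laplacian q = 0 → ∀ x : 𝔼, Δ (toFun q) x = 0 :=
    fun q hq x => by rw [laplacian_toFun, hq]; simp [toFun]
  have hmul : ∀ x : 𝔼, toFun (spherePoly c ρ * p) x = (ρ ^ 2 - ‖x - c‖ ^ 2) * toFun p x :=
    fun x => by rw [← toFun_spherePoly]; simp [toFun]
  have hle : ∀ q : MvPolynomial (Fin m) ℝ, laplacian (spherePoly c ρ * q) = 0 →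
      ∀ x ∈ Metric.ball c ρ, 0 ≤ toFun (spherePoly c ρ * q) x := by
    intro q hq x hx
    -- With `v = 0` the comparison is the classical minimum principle; applying it to `p` and `-p`
    -- gives equality.
    have := sub_le_of_sub_le_sphere (v := fun _ : 𝔼 => (0 : ℝ)) contDiff_const
      (contDiff_toFun (spherePoly c ρ * q)) (hΔ _ hq) (c := c) (ρ := ρ) (B := 0)
      (fun y _ => ⟨0, 1, one_pos, fun R _ => by simp [ballMeanDeriv]⟩)
      (fun y hy => by
        have h1 : toFun (spherePoly c ρ * q) y = toFun (spherePoly c ρ) y * toFun q y := by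
          simp [toFun]
        rw [h1, toFun_spherePoly, ← dist_eq_norm, Metric.mem_sphere.1 hy]
        simp)
      (Metric.ball_subset_closedBall hx)
    linarith
  refine eq_zero_of_toFun_eq_zero_on_ball (c := c) hρ fun x hx => ?_
  have h1 := hle p hp x hx
  have h2 := hle (-p) (by rw [mul_neg, map_neg, hp, neg_zero]) x hx
  have h3 : toFun (spherePoly c ρ * -p) x = -toFun (spherePoly c ρ * p) x := by simp [toFun]
  have h4 := hmul x
  rw [show toFun (spherePoly c ρ * p) x = 0 by linarith] at h4
  have h5 : 0 < ρ ^ 2 - ‖x - c‖ ^ 2 := by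
    rw [← dist_eq_norm]
    have := Metric.mem_ball.1 hx
    nlinarith [dist_nonneg (x := x) (y := c)]
  exact (mul_eq_zero.1 h4.symm).resolve_left h5.ne'

/-- The Dirichlet problem on a ball with polynomial boundary values has a polynomial solution. -/
theorem exists_harmonic_eq_on_sphere (c : 𝔼) {ρ : ℝ} (hρ : 0 < ρ) (q : MvPolynomial (Fin m) ℝ) :
    ∃ p : MvPolynomial (Fin m) ℝ, laplacian p = 0 ∧
      ∀ x ∈ Metric.sphere c ρ, toFun p x = toFun q x := by
  set T : MvPolynomial (Fin m) ℝ →ₗ[ℝ] MvPolynomial (Fin m) ℝ :=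
    laplacian ∘ₗ LinearMap.mulLeft ℝ (spherePoly c ρ)
  -- Multiplication by `spherePoly` raises the degree by at most 2 and the Laplacian lowers it by 2,
  -- so `T` acts on a finite-dimensional space, where injectivity yields surjectivity.
  have hT : ∀ p ∈ restrictTotalDegree (Fin m) ℝ q.totalDegree,
      T p ∈ restrictTotalDegree (Fin m) ℝ q.totalDegree := by
    intro p hp
    rw [mem_restrictTotalDegree] at hp ⊢
    have h1 := totalDegree_laplacian_le (spherePoly c ρ * p)
    have h2 := totalDegree_mul (spherePoly c ρ) p
    have h3 := totalDegree_spherePoly_le c ρ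
    change (laplacian (spherePoly c ρ * p)).totalDegree ≤ _
    omega
  have hinj : Function.Injective (T.restrict hT) := by
    rw [injective_iff_map_eq_zero]
    intro p hp
    exact Subtype.ext (laplacian_spherePoly_mul_injective hρ (congrArg Subtype.val hp))
  have hq : laplacian q ∈ restrictTotalDegree (Fin m) ℝ q.totalDegree := by
    rw [mem_restrictTotalDegree]
    exact (totalDegree_laplacian_le q).trans (Nat.sub_le _ _)
  obtain ⟨p, hp⟩ := LinearMap.injective_iff_surjective.1 hinj ⟨_, hq⟩
  have hp' : laplacian (spherePoly c ρ * p.1) = laplacian q := congrArg Subtype.val hp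
  refine ⟨q - spherePoly c ρ * p.1, by rw [map_sub, hp', sub_self], fun x hx => ?_⟩
  have h1 : toFun (q - spherePoly c ρ * p.1) x = toFun q x - toFun (spherePoly c ρ) x * toFun p.1 x
      := by simp [toFun]
  rw [h1, toFun_spherePoly, ← dist_eq_norm, Metric.mem_sphere.1 hx]
  simp

end MvPolynomial

/-! ### Mean value property and its converse -/

section MeanValue

variable {E : Type*} [NormedAddCommGroup E] [InnerProductSpace ℝ E] [FiniteDimensional ℝ E]
  [MeasurableSpace E] [BorelSpace E]

/-- The mean value property of harmonic functions. -/
theorem ballMean_eq_of_laplacian_eq_zero {h : E → ℝ} (hh : ContDiff ℝ 2 h)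
    (hΔ : ∀ x, Δ h x = 0) (x : E) (R : ℝ) : ballMean h x R = h x * ∫ y : E, ballKernel y := by
  have hd : ∀ s, HasDerivAt (ballMean h x) 0 s := fun s => by
    have h1 := hasDerivAt_ballMean (hh.of_le (by norm_num)) x s
    rw [ballMeanDeriv_eq_integral_laplacian hh] at h1
    simpa [hΔ] using h1
  rw [← ballMean_zero]
  exact is_const_of_deriv_eq_zero (fun s => (hd s).differentiableAt) (fun s => (hd s).deriv) R 0

/-- Weighted ball means of a continuous function are smooth in the centre. -/
theorem contDiff_ballMean {v : E → ℝ} (hv : Continuous v) {R : ℝ} (hR : 0 < R) {n : ℕ∞} :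
    ContDiff ℝ n fun x => ballMean v x R := by
  have hk : ContDiff ℝ n fun t : E => ballKernel (R⁻¹ • t) :=
    ballKernel_contDiff.comp (contDiff_const.smul contDiff_id)
  have hkc : HasCompactSupport fun t : E => ballKernel (R⁻¹ • t) :=
    ballKernel_hasCompactSupport.comp_homeomorph (Homeomorph.smulOfNeZero R⁻¹ (by positivity))
  have hconv := hkc.contDiff_convolution_left (ContinuousLinearMap.mul ℝ ℝ) hk
    (hv.locallyIntegrable (μ := (volume : Measure E)))
  have heq : (fun x => ballMean v x R) = fun x => |(R ^ finrank ℝ E)⁻¹| •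
      (convolution (fun t : E => ballKernel (R⁻¹ • t)) v
        (ContinuousLinearMap.mul ℝ ℝ) volume) x := by
    funext x
    -- Substitute `t = R y` in the convolution; the reflection `y ↦ -y` matches the signs, as the
    -- kernel is even.
    rw [convolution, ← Measure.integral_comp_smul, ballMean,
      ← integral_neg_eq_self (fun y => v (x + R • y) * ballKernel y)]
    congr 1
    funext y
    simp [ballKernel_neg, smul_smul, inv_mul_cancel₀ hR.ne', mul_comm, sub_eq_add_neg]
  rw [heq]
  exact hconv.const_smul _

/-- The converse of the mean value property for functions of class `C²`. -/
theorem laplacian_eq_zero_of_ballMean_eq {V : E → ℝ} (hV : ContDiff ℝ 2 V) {x : E} {δ : ℝ}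
    (hδ : 0 < δ) (h : ∀ R ∈ Ioo 0 δ, ballMean V x R = V x * ∫ y : E, ballKernel y) :
    Δ V x = 0 := by
  -- This is the derivative of the mean divided by `R`. It vanishes for small `R > 0`, hence by
  -- continuity at 0, where it is `Δ V x` times a positive constant.
  set I : ℝ → ℝ := fun R => ∫ y, Δ V (x + R • y) * ballPotential y
  have hI0 : ∀ R ∈ Ioo 0 δ, I R = 0 := fun R hR => by
    have h1 := hasDerivAt_ballMean (hV.of_le (by norm_num)) x R
    rw [ballMeanDeriv_eq_integral_laplacian hV] at h1
    have h2 : ballMean V x =ᶠ[𝓝 R] fun _ => V x * ∫ y : E, ballKernel y := by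
      filter_upwards [Ioo_mem_nhds hR.1 hR.2] with s hs using h s hs
    have h3 := h1.unique ((hasDerivAt_const R _).congr_of_eventuallyEq h2)
    exact (mul_eq_zero.1 h3).resolve_left hR.1.ne'
  have hIc : Continuous I := by
    have h1 : I = fun R => ∫ y in Metric.closedBall 0 1, Δ V (x + R • y) * ballPotential y := by
      funext R
      refine (setIntegral_eq_integral_of_forall_compl_eq_zero fun y hy => ?_).symm
      rw [ballPotential_eq_zero (le_of_lt (by simpa using hy)), mul_zero]
    rw [h1]
    refine continuous_parametric_integral_of_continuous ?_ (isCompact_closedBall 0 1)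
    have h2 := hV.continuous_laplacian
    have h3 := ballPotential_continuous (E := E)
    simp only [Function.uncurry_def]
    fun_prop
  have hlim : Tendsto I (𝓝[>] 0) (𝓝 0) := by
    refine tendsto_const_nhds.congr' ?_
    filter_upwards [Ioo_mem_nhdsGT hδ] with R hR using (hI0 R hR).symm
  have h0 : I 0 = 0 := tendsto_nhds_unique (hIc.continuousWithinAt.tendsto) hlim
  simp only [I, zero_smul, add_zero, integral_const_mul] at h0
  exact (mul_eq_zero.1 h0).resolve_right integral_ballPotential_pos.ne'

/-- A continuous function with the weighted mean value property on a ball is harmonic at its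
centre. -/
theorem harmonicAt_of_ballMean_eq [Nontrivial E] {v : E → ℝ} (hv : Continuous v) {c : E} {ρ : ℝ}
    (hρ : 0 < ρ) (h : ∀ x R, 0 < R → Metric.closedBall x R ⊆ Metric.closedBall c ρ →
      ballMean v x R = v x * ∫ y : E, ballKernel y) : HarmonicAt v c := by
  set K := ∫ y : E, ballKernel y
  have hK : 0 < K := integral_ballKernel_pos
  -- Averaging at the fixed radius `ρ / 2` smooths `v` without changing it on the half ball, whose
  -- points keep their averaging balls inside the original one.
  set V : E → ℝ := fun x => ballMean v x (ρ / 2) / K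
  have hV : ContDiff ℝ 2 V :=
    (contDiff_ballMean hv (half_pos hρ) (n := 2)).div_const K
  have hVv : ∀ x ∈ Metric.ball c (ρ / 2), V x = v x := fun x hx => by
    have h1 : ballMean v x (ρ / 2) = v x * K := h x _ (half_pos hρ)
      (Metric.closedBall_subset_closedBall' (by linarith [Metric.mem_ball.1 hx]))
    simp only [V, h1]
    field_simp
  have hΔ : ∀ x ∈ Metric.ball c (ρ / 2), Δ V x = 0 := fun x hx => by
    refine laplacian_eq_zero_of_ballMean_eq hV (sub_pos.2 (Metric.mem_ball.1 hx)) fun R hR => ?_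
    have hsub : Metric.closedBall x R ⊆ Metric.ball c (ρ / 2) :=
      Metric.closedBall_subset_ball' (by linarith [hR.2])
    have h1 : ballMean V x R = ballMean v x R :=
      le_antisymm
        (ballMean_mono hV.continuous hv hR.1.le fun y hy => (hVv y (hsub hy)).le)
        (ballMean_mono hv hV.continuous hR.1.le fun y hy => (hVv y (hsub hy)).ge)
    rw [h1, hVv x hx]
    exact h x R hR.1 (hsub.trans (Metric.ball_subset_closedBall.trans
      (Metric.closedBall_subset_closedBall (by linarith))))
  have hnhds : Metric.ball c (ρ / 2) ∈ 𝓝 c := Metric.ball_mem_nhds c (half_pos hρ)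
  have hEq : V =ᶠ[𝓝 c] v := by filter_upwards [hnhds] with x hx using hVv x hx
  rw [← harmonicAt_congr_nhds hEq]
  exact ⟨hV.contDiffAt, by filter_upwards [hnhds] with x hx using hΔ x hx⟩

end MeanValue

/-! ### Harmonic approximation and passage to the limit -/

section Local

variable {m : ℕ} [Nontrivial (EuclideanSpace ℝ (Fin m))]

local notation "𝔼" => EuclideanSpace ℝ (Fin m)

/-- Approximate `v` on the sphere by a polynomial, replace it by the harmonic polynomial with the
same boundary values, and let the maximum principle for `±(v - h)` carry the error inside. -/
theorem exists_harmonic_poly_near {v : 𝔼 → ℝ} (hv : ContDiff ℝ 1 v) {c : 𝔼} {ρ : ℝ} (hρ : 0 < ρ)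
    (hmean : ∀ x ∈ Metric.ball c ρ,
      ∃ C : ℝ, ∃ δ > 0, ∀ R ∈ Ioo 0 δ, |ballMeanDeriv v x R| ≤ C * R ^ 2)
    {ε : ℝ} (hε : 0 < ε) :
    ∃ h : 𝔼 → ℝ, ContDiff ℝ 2 h ∧ (∀ x, Δ h x = 0) ∧
      ∀ x ∈ Metric.closedBall c ρ, |v x - h x| ≤ ε := by
  obtain ⟨q, hq⟩ := MvPolynomial.exists_toFun_near (Metric.sphere c ρ) (isCompact_sphere c ρ)
    hv.continuous hε
  obtain ⟨p, hp, hpq⟩ := MvPolynomial.exists_harmonic_eq_on_sphere c hρ q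
  have hΔ : ∀ x, Δ (p.toFun : 𝔼 → ℝ) x = 0 := fun x => by
    rw [MvPolynomial.laplacian_toFun, hp]; simp [MvPolynomial.toFun]
  have hpC : ContDiff ℝ 2 (p.toFun : 𝔼 → ℝ) := p.contDiff_toFun
  have hs : ∀ x ∈ Metric.sphere c ρ, |v x - p.toFun x| ≤ ε := fun x hx => by
    rw [hpq x hx]; exact hq x hx
  refine ⟨p.toFun, hpC, hΔ, fun x hx => abs_le.2 ⟨?_, ?_⟩⟩
  · have h1 := sub_le_of_sub_le_sphere (v := -v) (h := -p.toFun) hv.neg hpC.neg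
      (fun y => by rw [InnerProductSpace.laplacian_neg, Pi.neg_apply, hΔ, neg_zero])
      (fun y hy => by
        have h2 : ∀ R, ballMeanDeriv (-v) y R = -ballMeanDeriv v y R := fun R => by
          simp [ballMeanDeriv, fderiv_neg, integral_neg]
        simpa only [h2, abs_neg] using hmean y hy)
      (B := ε) (fun y hy => by
        have := (abs_le.1 (hs y hy)).1
        simp only [Pi.neg_apply]; linarith) hx
    simp only [Pi.neg_apply] at h1
    linarith
  · exact sub_le_of_sub_le_sphere hv hpC hΔ hmean (fun y hy => (abs_le.1 (hs y hy)).2) hx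

theorem harmonicAt_of_ballMeanDeriv_le {v : 𝔼 → ℝ} (hv : ContDiff ℝ 1 v) {c : 𝔼} {ρ : ℝ}
    (hρ : 0 < ρ) (hmean : ∀ x ∈ Metric.ball c ρ,
      ∃ C : ℝ, ∃ δ > 0, ∀ R ∈ Ioo 0 δ, |ballMeanDeriv v x R| ≤ C * R ^ 2) : HarmonicAt v c := by
  refine harmonicAt_of_ballMean_eq hv.continuous hρ fun x R hR hsub => ?_
  set K := ∫ y : 𝔼, ballKernel y
  have hK : 0 < K := integral_ballKernel_pos
  have hx : x ∈ Metric.closedBall c ρ := hsub (Metric.mem_closedBall_self hR.le)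
  refine eq_of_abs_sub_nonpos (le_of_forall_pos_le_add fun η hη => ?_)
  -- Replacing `v` by `h` costs `ε * K` in the mean and `ε * K` in the value at `x`.
  set ε := η / (2 * K)
  have hε : 0 < ε := by positivity
  have hεη : 2 * (ε * K) = η := by simp only [ε]; field_simp
  obtain ⟨h, hh, hΔ, hvh⟩ := exists_harmonic_poly_near hv hρ hmean hε
  have h1 : ballMean h x R = h x * K := ballMean_eq_of_laplacian_eq_zero hh hΔ x R
  have hhε : ∀ a : ℝ, Continuous fun y => h y + a := fun a => hh.continuous.add continuous_const
  have h2 : ∀ a : ℝ, ballMean (fun y => h y + a) x R = h x * K + a * K := fun a => by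
    rw [ballMean_add hh.continuous continuous_const, ballMean_const, h1]
  have h3 : ballMean v x R ≤ h x * K + ε * K := by
    rw [← h2]
    exact ballMean_mono hv.continuous (hhε ε) hR.le fun y hy => by
      linarith [(abs_le.1 (hvh y (hsub hy))).2]
  have h4 : h x * K + -ε * K ≤ ballMean v x R := by
    rw [← h2]
    exact ballMean_mono (hhε _) hv.continuous hR.le fun y hy => by
      linarith [(abs_le.1 (hvh y (hsub hy))).1]
  have h5 := abs_le.1 (hvh x hx)
  have h6 : (v x - h x) * K ≤ ε * K := mul_le_mul_of_nonneg_right h5.2 hK.le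
  have h7 : -ε * K ≤ (v x - h x) * K := mul_le_mul_of_nonneg_right h5.1 hK.le
  rw [zero_add, abs_le]
  constructor <;> linarith

end Local

/-- Multiply by a bump function supported in `D`; the kernel integrals above require functions that
are regular on the whole space. -/
theorem ContDiffOn.exists_contDiff_eqOn_ball {E : Type*} [NormedAddCommGroup E]
    [InnerProductSpace ℝ E] [FiniteDimensional ℝ E] {n : ℕ∞} {u : E → ℝ} {D : Set E}
    (hu : ContDiffOn ℝ n u D) (hD : IsOpen D) {c : E} (hc : c ∈ D) :
    ∃ v : E → ℝ, ∃ ρ > 0, ContDiff ℝ n v ∧ EqOn v u (Metric.ball c ρ) ∧ Metric.ball c ρ ⊆ D := by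
  obtain ⟨r, hr, hsub⟩ := Metric.nhds_basis_closedBall.mem_iff.1 (hD.mem_nhds hc)
  let χ : ContDiffBump c := ⟨r / 2, r, half_pos hr, half_lt_self hr⟩
  refine ⟨fun y => χ y * u y, r / 2, half_pos hr, contDiff_iff_contDiffAt.2 fun y => ?_,
    fun y hy => ?_, ?_⟩
  · by_cases hy : y ∈ D
    · exact χ.contDiffAt.mul (hu.contDiffAt (hD.mem_nhds hy))
    · have hy' : y ∉ tsupport χ := by
        rw [χ.tsupport_eq]
        exact fun h => hy (hsub h)
      have h0 : (fun y => χ y * u y) =ᶠ[𝓝 y] fun _ => 0 := by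
        filter_upwards [notMem_tsupport_iff_eventuallyEq.1 hy'] with z hz
        simp [hz]
      exact contDiffAt_const.congr_of_eventuallyEq h0
  · simp [χ.one_of_mem_closedBall (Metric.ball_subset_closedBall hy)]
  · exact (Metric.ball_subset_closedBall.trans
      (Metric.closedBall_subset_closedBall (by linarith))).trans hsub

end

theorem theorem2p3 (m : ℕ) (hm : 2 ≤ m) (D : Set (EuclideanSpace ℝ (Fin m)))
    (hDo : IsOpen D) (hDc : IsConnected D) (hDb : Bornology.IsBounded D)
    (u : EuclideanSpace ℝ (Fin m) → ℝ) (hu : ContDiffOn ℝ 1 u D)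
    (hflux : ∀ x ∈ D,
      Filter.Tendsto (fun r : ℝ => 1 / (sphereArea m r * r ^ 2) * sphereFlux u x r)
        (nhdsWithin 0 (Set.Ioi 0)) (nhds 0)) :
    InnerProductSpace.HarmonicOnNhd u D := by
  have : Nontrivial (EuclideanSpace ℝ (Fin m)) :=
    Module.nontrivial_of_finrank_pos (R := ℝ) (by simp; omega)
  intro c hc
  obtain ⟨v, ρ, hρ, hv, hvu, hsub⟩ := hu.exists_contDiff_eqOn_ball (n := 1) hDo hc
  rw [← InnerProductSpace.harmonicAt_congr_nhds
    (hvu.eventuallyEq_of_mem (Metric.ball_mem_nhds c hρ))]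
  refine harmonicAt_of_ballMeanDeriv_le hv hρ fun x hx => exists_ballMeanDeriv_le hv x ?_
  refine (hflux x (hsub hx)).congr' ?_
  filter_upwards [sphereFlux_eventuallyEq Metric.isOpen_ball hvu hx] with r hr
  rw [hr]
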